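/- Let $A\subset C$ and $B\subset D$ be inclusions of $C^*$-algebras with $\overline{AC}=C$ and $\overline{BD}=D$ (closed linear spans), and let $E^A:C\to A$ and $E^B:D\to B$ be conditional expectations. Suppose that the inclusions $A\subset C$ and $B\subset D$ are strongly Morita equivalent with respect to a $C$-$D$-equivalence bimodule $Y$ and its closed subspace $X$; that is, $A\cdot X\subset X$, $X\cdot B\subset X$, ${}_C\langle X,X\rangle\subset A$, $\langle X,X\rangle_D\subset B$, and, as closed linear spans, $\overline{{}_C\langle X,X\rangle}=A$, $\overline{{}_C\langle Y,X\rangle}=C$, $\overline{\langle X,X\rangle_D}=B$, $\overline{\langle Y,X\rangle_D}=D$. Let $\pi_B$ be a non-degenerate representation of $B$ on a Hilbert space $\mathcal K_B$ (inner products of Hilbert spaces are linear in the second variable). Define the following Hilbert spaces, each as the separated completion of the algebraic tensor product for the given form, and representations: * $\mathcal H_A=X\otimes_B\mathcal K_B$, $\langle x\otimes\xi,x_1\otimes\xi_1\rangle=\langle\xi,\pi_B(\langle x,x_1\rangle_B)\xi_1\rangle$, $\pi_A(a)(x\otimes\xi)=(a\cdot x)\otimes\xi$ for $a\in A$, where $\langle\cdot,\cdot\rangle_B$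 is the restriction of $\langle\cdot,\cdot\rangle_D$ to $X$; * $\mathcal K_D$, the completion of $D\odot\mathcal K_B$, $\langle d\otimes\xi,d_1\otimes\xi_1\rangle=\langle\xi,\pi_B(E^B(d^*d_1))\xi_1\rangle$, $\pi_D(d)(d_1\otimes\xi)=dd_1\otimes\xi$ for $d\in D$ (the minimal Stinespring representation of $\pi_B\circ E^B$); * $\mathcal H_C=Y\otimes_D\mathcal K_D$, $\langle y\otimes\zeta,y_1\otimes\zeta_1\rangle=\langle\zeta,\pi_D(\langle y,y_1\rangle_D)\zeta_1\rangle$, $\pi_C(c)(y\otimes\zeta)=(c\cdot y)\otimes\zeta$ for $c\in C$. Let $V_C:\mathcal H_A\to\mathcal H_C$ be the bounded linear map (it is an isometry) determined by $$V_C(x\otimes\xi)=\lim_\lambda x\otimes(d_\lambda\otimes\xi)\qquad(x\in X,\ \xi\in\mathcal K_B),$$ where $\{d_\lambda\}_\lambda$ is an approximate unit of $D$ with $d_\lambda\ge0$ and $\|d_\lambda\|\le1$ for all $\lambda$, and the limit is taken in the weak topology of $\mathcal H_C$. Suppose that $\pi_B$ is faithful and that $\pi_A(E^A(c))=V_C^*\pi_C(c)V_C$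 for all $c\in C$. Then $E^A$ and $E^B$ are strongly Morita equivalent as bimodule linear maps, with respect to $Y$ and $X$; that is, there is a bounded linear map $\Phi:Y\to X$ such that, for all $a\in A$, $b\in B$, $c\in C$, $d\in D$, $x\in X$, $y\in Y$, $$\Phi(c\cdot x)=E^A(c)\cdot x,\quad \Phi(a\cdot y)=a\cdot\Phi(y),\quad E^A({}_C\langle y,x\rangle)={}_C\langle\Phi(y),x\rangle,$$ $$\Phi(x\cdot d)=x\cdot E^B(d),\quad \Phi(y\cdot b)=\Phi(y)\cdot b,\quad E^B(\langle y,x\rangle_D)=\langle\Phi(y),x\rangle_D.$$ -/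

import Mathlib

open Filter Topology
open scoped InnerProductSpace TensorProduct

set_option linter.unusedSectionVars false

namespace MoritaMaps

/-! ### Positivity in C*-algebras -/

/-- The order inherited by a closed star-subalgebra is its own C*-algebraic order. -/
instance closedSubalgebraStarOrderedRing {D : Type*} [NonUnitalCStarAlgebra D] [PartialOrder D]
    [StarOrderedRing D] (B : NonUnitalStarSubalgebra ℂ D) [hB : IsClosed (B : Set D)] :
    StarOrderedRing B :=
  StarOrderedRing.of_nonneg_iff' (fun {x y} h z => by
      change (z : D) + x ≤ z + y
      exact add_le_add_right (show (x : D) ≤ y from h) _)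
    (fun x => by
      constructor
      · intro hx
        have hx' : (0 : D) ≤ x := hx
        have hm : CFC.sqrt (x : D) ∈ B := by
          rw [CFC.sqrt_eq_real_sqrt (x : D) hx']
          exact cfcₙ_mem (𝕜' := ℂ) _ x.2
        refine ⟨⟨CFC.sqrt (x : D), hm⟩, Subtype.ext ?_⟩
        change (x : D) = star (CFC.sqrt (x : D)) * CFC.sqrt (x : D)
        rw [(CFC.sqrt_nonneg (x : D)).isSelfAdjoint.star_eq, CFC.sqrt_mul_sqrt_self (x : D) hx']
      · rintro ⟨s, rfl⟩
        exact star_mul_self_nonneg (s : D))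

section Positivity

variable {ι B : Type*} [Fintype ι] [NonUnitalCStarAlgebra B] [PartialOrder B] [StarOrderedRing B]

theorem exists_decomposition {R : Type*} [NonUnitalCStarAlgebra R] [PartialOrder R]
    [StarOrderedRing R] (a : R) (ha : IsSelfAdjoint a) :
    ∃ p n : R, 0 ≤ p ∧ 0 ≤ n ∧ a = p - n ∧ n * p = 0 :=
  ⟨a⁺, a⁻, CFC.posPart_nonneg a, CFC.negPart_nonneg a, (CFC.posPart_sub_negPart a ha).symm,
    CFC.negPart_mul_posPart a⟩

theorem exists_eq_star_mul_self {R : Type*} [NonUnitalCStarAlgebra R] [PartialOrder R]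
    [StarOrderedRing R] {a : R} (ha : 0 ≤ a) : ∃ s : R, a = star s * s :=
  CStarAlgebra.nonneg_iff_eq_star_mul_self.mp ha

/-- A self-adjoint matrix `M` over a C*-algebra with `∑ bᵢ* Mᵢⱼ bⱼ ≥ 0` for all columns `b` is
positive. -/
theorem cstarMatrix_nonneg (M : CStarMatrix ι ι B) (hM : IsSelfAdjoint M)
    (h : ∀ b : ι → B, 0 ≤ ∑ i, ∑ j, star (b i) * M i j * b j) : 0 ≤ M := by
  classical
  obtain ⟨P, N, hP, hN, hPN, hNP⟩ := exists_decomposition M hM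
  have hNs : star N = N := hN.isSelfAdjoint.star_eq
  have hNe : ∀ i j, star (N j i) = N i j := fun i j => by
    conv_rhs => rw [← hNs]
    rfl
  have hNMN : N * M * N = -(N * N * N) := by
    rw [hPN, mul_sub, hNP, zero_sub, neg_mul]
  have hN3 : 0 ≤ N * N * N := by
    have := star_left_conjugate_nonneg hN N
    rwa [hNs] at this
  obtain ⟨S, hS⟩ := exists_eq_star_mul_self hN3
  have hdiag : ∀ i, (N * N * N) i i = ∑ k, star (S k i) * S k i := fun i => by
    rw [hS, CStarMatrix.mul_apply]; rfl
  have hdiag2 : ∀ i, (N * N * N) i i ≤ 0 := fun i => by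
    have h1 : 0 ≤ (N * M * N) i i := by
      rw [CStarMatrix.mul_apply]
      simp only [CStarMatrix.mul_apply, Finset.sum_mul]
      rw [Finset.sum_comm]
      refine (h fun k => N k i).trans_eq ?_
      simp only [hNe]
    rw [hNMN, CStarMatrix.neg_apply] at h1
    exact neg_nonneg.mp h1
  have hS0 : S = 0 := by
    ext k i
    have h0 : ∑ k, star (S k i) * S k i = 0 :=
      le_antisymm (hdiag i ▸ hdiag2 i) (Finset.sum_nonneg fun k _ => star_mul_self_nonneg _)
    have := (Finset.sum_eq_zero_iff_of_nonneg fun k _ => star_mul_self_nonneg (S k i)).mp h0 k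
      (Finset.mem_univ _)
    exact CStarRing.star_mul_self_eq_zero_iff _ |>.mp this
  have hNN : N * N = 0 := by
    rw [← CStarRing.star_mul_self_eq_zero_iff (N * N), star_mul, hNs, ← mul_assoc, hS, hS0]
    simp
  have hN0 : N = 0 := by
    rw [← CStarRing.star_mul_self_eq_zero_iff N, hNs, hNN]
  rw [hPN, hN0, sub_zero]
  exact hP

variable {K : Type*} [NormedAddCommGroup K] [InnerProductSpace ℂ K] [CompleteSpace K]

theorem sum_inner_nonneg (π : B →⋆ₙₐ[ℂ] (K →L[ℂ] K)) (M : CStarMatrix ι ι B)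
    (hM : IsSelfAdjoint M)
    (h : ∀ b : ι → B, 0 ≤ ∑ i, ∑ j, star (b i) * M i j * b j) (ξ : ι → K) :
    0 ≤ (∑ i, ∑ j, ⟪ξ i, π (M i j) (ξ j)⟫_ℂ).re := by
  obtain ⟨S, hS⟩ := exists_eq_star_mul_self (cstarMatrix_nonneg M hM h)
  have key : ∑ i, ∑ j, ⟪ξ i, π (M i j) (ξ j)⟫_ℂ
      = ∑ k, ⟪∑ i, π (S k i) (ξ i), ∑ i, π (S k i) (ξ i)⟫_ℂ := by
    have : ∀ i j, M i j = ∑ k, star (S k i) * S k j := fun i j => by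
      rw [hS, CStarMatrix.mul_apply]; rfl
    simp only [this, map_sum, map_mul, map_star, _root_.sum_apply, inner_sum,
      sum_inner, mul_apply_eq_comp, ContinuousLinearMap.star_eq_adjoint,
      ContinuousLinearMap.adjoint_inner_right]
    rw [Finset.sum_congr rfl fun i _ => Finset.sum_comm, Finset.sum_comm]
    refine Finset.sum_congr rfl fun k _ => ?_
    rw [Finset.sum_comm]
  rw [key, Complex.re_sum]
  exact Finset.sum_nonneg fun k _ => inner_self_nonneg (𝕜 := ℂ)

end Positivity

/-! ### Right Hilbert bimodules and the Hilbert space `E ⊗_B K` -/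

/-- A `C`-`B`-bimodule `E` with a `B`-valued semi-inner product (conjugate linear in the first and
linear in the second variable) on which `C` acts by adjointable operators: `lsmul c x` is `c · x`,
`rsmul x b` is `x · b` and `rinner x y` is `⟨x, y⟩_B`. -/
structure Correspondence (C B E : Type*) [NonUnitalCStarAlgebra C] [NonUnitalCStarAlgebra B]
    [PartialOrder B] [AddCommGroup E] [Module ℂ E] where
  lsmul : C →ₗ[ℂ] E →ₗ[ℂ] E
  rsmul : E →ₗ[ℂ] B →ₗ[ℂ] E
  rinner : E →ₗ⋆[ℂ] E →ₗ[ℂ] B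
  mul_lsmul : ∀ c c' x, lsmul (c * c') x = lsmul c (lsmul c' x)
  rsmul_mul : ∀ x b b', rsmul x (b * b') = rsmul (rsmul x b) b'
  lsmul_rsmul : ∀ c x b, lsmul c (rsmul x b) = rsmul (lsmul c x) b
  rinner_rsmul : ∀ x y b, rinner x (rsmul y b) = rinner x y * b
  star_rinner : ∀ x y, star (rinner x y) = rinner y x
  rinner_lsmul : ∀ c x y, rinner (lsmul c x) y = rinner x (lsmul (star c) y)
  rinner_self_nonneg : ∀ x, 0 ≤ rinner x x

section Form

variable {B E K : Type*} [NonUnitalCStarAlgebra B] [AddCommGroup E] [Module ℂ E]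
  [NormedAddCommGroup K] [InnerProductSpace ℂ K] [CompleteSpace K]

/-- The sesquilinear form on `E ⊗ K` with `⟨x ⊗ ξ, y ⊗ η⟩ = ⟨ξ, π ⟨x, y⟩ η⟩`. -/
noncomputable def tensorForm (π : B →⋆ₙₐ[ℂ] (K →L[ℂ] K)) (f : E →ₗ⋆[ℂ] E →ₗ[ℂ] B) :
    (E ⊗[ℂ] K) →ₗ⋆[ℂ] (E ⊗[ℂ] K) →ₗ[ℂ] ℂ :=
  TensorProduct.lift
    (LinearMap.mk₂'ₛₗ (starRingEnd ℂ) (starRingEnd ℂ)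
      (fun x ξ => TensorProduct.lift
        (LinearMap.mk₂ ℂ (fun y η => ⟪ξ, π (f x y) η⟫_ℂ)
          (by intros; simp) (by intros; simp) (by intros; simp) (by intros; simp)))
      (by intros; ext; simp) (by intros; ext; simp) (by intros; ext; simp)
      (by intros; ext; simp [mul_comm]))

@[simp]
theorem tensorForm_tmul (π : B →⋆ₙₐ[ℂ] (K →L[ℂ] K)) (f : E →ₗ⋆[ℂ] E →ₗ[ℂ] B) (x y : E) (ξ η : K) :
    tensorForm π f (x ⊗ₜ ξ) (y ⊗ₜ η) = ⟪ξ, π (f x y) η⟫_ℂ := by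
  simp [tensorForm]

theorem tensorForm_conj (π : B →⋆ₙₐ[ℂ] (K →L[ℂ] K)) (f : E →ₗ⋆[ℂ] E →ₗ[ℂ] B)
    (hf : ∀ x y, star (f x y) = f y x) (s t : E ⊗[ℂ] K) :
    (starRingEnd ℂ) (tensorForm π f t s) = tensorForm π f s t := by
  induction s with
  | zero => simp
  | add s s' hs hs' => simp [hs, hs']
  | tmul x ξ =>
    induction t with
    | zero => simp
    | add t t' ht ht' => simp [ht, ht']
    | tmul y η =>
      rw [tensorForm_tmul, tensorForm_tmul, inner_conj_symm, ← hf y x, map_star,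
        ContinuousLinearMap.star_eq_adjoint, ContinuousLinearMap.adjoint_inner_right]

theorem tensorForm_self_nonneg [PartialOrder B] [StarOrderedRing B] (π : B →⋆ₙₐ[ℂ] (K →L[ℂ] K))
    (f : E →ₗ⋆[ℂ] E →ₗ[ℂ] B) (r : E →ₗ[ℂ] B →ₗ[ℂ] E)
    (hr : ∀ x y b, f x (r y b) = f x y * b) (hf : ∀ x y, star (f x y) = f y x)
    (hp : ∀ x, 0 ≤ f x x) (t : E ⊗[ℂ] K) : 0 ≤ (tensorForm π f t t).re := by
  obtain ⟨k, x, ξ, rfl⟩ := TensorProduct.exists_sum_tmul_eq t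
  simp only [map_sum, LinearMap.sum_apply, tensorForm_tmul]
  rw [Finset.sum_comm]
  refine sum_inner_nonneg π (CStarMatrix.ofMatrix fun i j => f (x i) (x j)) ?_ ?_ ξ
  · ext i j
    exact hf _ _
  · intro b
    have hl : ∀ x y b, f (r x b) y = star b * f x y := fun x y b => by
      rw [← hf, hr, star_mul, hf]
    refine (hp (∑ i, r (x i) (b i))).trans_eq ?_
    simp only [map_sum, LinearMap.sum_apply, hr, hl]
    rw [Finset.sum_comm]
    rfl

end Form

namespace Correspondence

variable {C B E K : Type*} [NonUnitalCStarAlgebra C] [NonUnitalCStarAlgebra B]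
  [PartialOrder B] [StarOrderedRing B] [AddCommGroup E] [Module ℂ E]
  [NormedAddCommGroup K] [InnerProductSpace ℂ K] [CompleteSpace K]

/-- The algebraic tensor product of `E` and `K`, carrying the semi-inner product
`⟨x ⊗ ξ, y ⊗ η⟩ = ⟨ξ, π ⟨x, y⟩ η⟩`. -/
def PreTensor (_P : Correspondence C B E) (_π : B →⋆ₙₐ[ℂ] (K →L[ℂ] K)) : Type _ := E ⊗[ℂ] K

variable (P : Correspondence C B E) (π : B →⋆ₙₐ[ℂ] (K →L[ℂ] K))

noncomputable instance : AddCommGroup (P.PreTensor π) := inferInstanceAs (AddCommGroup (E ⊗[ℂ] K))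
noncomputable instance : Module ℂ (P.PreTensor π) := inferInstanceAs (Module ℂ (E ⊗[ℂ] K))

/-- The identity map onto the semi-inner product space. -/
noncomputable def toPre : (E ⊗[ℂ] K) ≃ₗ[ℂ] P.PreTensor π := LinearEquiv.refl ℂ _

/-- The semi-inner product on the algebraic tensor product. -/
noncomputable abbrev preCore : PreInnerProductSpace.Core ℂ (P.PreTensor π) where
  inner s t := tensorForm π P.rinner ((P.toPre π).symm s) ((P.toPre π).symm t)
  conj_inner_symm s t := tensorForm_conj π P.rinner P.star_rinner _ _
  re_inner_nonneg t := tensorForm_self_nonneg π P.rinner P.rsmul P.rinner_rsmul P.star_rinner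
    P.rinner_self_nonneg _
  add_left s t u := by simp
  smul_left s t c := by simp

noncomputable instance : SeminormedAddCommGroup (P.PreTensor π) :=
  InnerProductSpace.Core.toSeminormedAddCommGroup (c := P.preCore π)
noncomputable instance : InnerProductSpace ℂ (P.PreTensor π) :=
  InnerProductSpace.ofCore (P.preCore π)

/-- The Hilbert space `E ⊗_B K`: the (Hausdorff) completion of the algebraic tensor product with
respect to `⟨x ⊗ ξ, y ⊗ η⟩ = ⟨ξ, π ⟨x, y⟩_B η⟩`, i.e. the completion of its quotient by the
vectors of length zero. -/
abbrev Tensor : Type _ := UniformSpace.Completion (P.PreTensor π)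

/-- The elementary tensor `x ⊗ ξ` in `E ⊗_B K`. -/
noncomputable def tmul (x : E) (ξ : K) : P.Tensor π := ((P.toPre π (x ⊗ₜ ξ) : P.PreTensor π) : P.Tensor π)

theorem pre_inner (s t : P.PreTensor π) : ⟪s, t⟫_ℂ =
    tensorForm π P.rinner ((P.toPre π).symm s) ((P.toPre π).symm t) := rfl

theorem inner_tmul (x y : E) (ξ η : K) :
    ⟪P.tmul π x ξ, P.tmul π y η⟫_ℂ = ⟪ξ, π (P.rinner x y) η⟫_ℂ := by
  simp [tmul, pre_inner]

/-- `⟨c · x, c · x⟩ ≤ ‖c‖² ⟨x, x⟩`. -/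
theorem rinner_lsmul_self_le (c : C) (x : E) :
    0 ≤ ((‖c‖ : ℂ) ^ 2) • P.rinner x x - P.rinner (P.lsmul c x) (P.lsmul c x) := by
  let _ : PartialOrder C := CStarAlgebra.spectralOrder C
  have _ : StarOrderedRing C := CStarAlgebra.spectralOrderedRing C
  have h1 : (0 : Unitization ℂ C) ≤ algebraMap ℝ _ ‖star c * c‖ - ((star c * c : C) : Unitization ℂ C) := by
    rw [sub_nonneg, ← Unitization.norm_inr (𝕜 := ℂ)]
    refine IsSelfAdjoint.le_algebraMap_norm_self ?_
    exact (IsSelfAdjoint.star_mul_self c).inr ℂ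
  obtain ⟨s, hs⟩ := exists_eq_star_mul_self h1
  have hf := congrArg (fun u : Unitization ℂ C => u.fst) hs
  have hsn := congrArg (fun u : Unitization ℂ C => u.snd) hs
  rw [CStarRing.norm_star_mul_self] at hf hsn
  have hx := P.rinner_self_nonneg (s.fst • x + P.lsmul s.snd x)
  simp [Algebra.algebraMap_eq_smul_one, sub_eq_add_neg, -Unitization.inr_mul, -Unitization.inr_star] at hf hsn
  refine hx.trans_eq ?_
  have e1 : star c * c = - (star s.fst • s.snd + s.fst • star s.snd + star s.snd * s.snd) := by
    rw [← neg_neg (star c * c), hsn]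
    rfl
  rw [P.rinner_lsmul c, ← P.mul_lsmul, e1, sq, hf]
  simp [P.rinner_lsmul, P.mul_lsmul, smul_smul, mul_comm]
  abel

/-- The operator `x ⊗ ξ ↦ (c · x) ⊗ ξ` before completion. -/
noncomputable def preLeft (c : C) : P.PreTensor π →L[ℂ] P.PreTensor π :=
  LinearMap.mkContinuous
    ((P.toPre π).toLinearMap ∘ₗ (TensorProduct.map (P.lsmul c) LinearMap.id) ∘ₗ
      (P.toPre π).symm.toLinearMap) ‖c‖ (by
    intro t
    set u : E ⊗[ℂ] K := (P.toPre π).symm t with hu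
    set T : (E ⊗[ℂ] K) →ₗ[ℂ] (E ⊗[ℂ] K) := TensorProduct.map (P.lsmul c) LinearMap.id
    let g : E →ₗ⋆[ℂ] E →ₗ[ℂ] B :=
      LinearMap.mk₂'ₛₗ (starRingEnd ℂ) (RingHom.id ℂ)
        (fun x y => ((‖c‖ : ℂ) ^ 2) • P.rinner x y - P.rinner (P.lsmul c x) (P.lsmul c y))
        (by intros; simp; abel) (by intros; simp [smul_sub, smul_smul, mul_comm])
        (by intros; simp; abel) (by intros; simp [smul_sub, smul_smul, mul_comm])
    have hg : ∀ x y, g x y = ((‖c‖ : ℂ) ^ 2) • P.rinner x y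
        - P.rinner (P.lsmul c x) (P.lsmul c y) := fun x y => rfl
    have hpos := tensorForm_self_nonneg π g P.rsmul
      (fun x y b => by
        rw [hg, hg, P.rinner_rsmul, P.lsmul_rsmul, P.rinner_rsmul, sub_mul, smul_mul_assoc])
      (fun x y => by
        rw [hg, hg, star_sub, star_smul, P.star_rinner, P.star_rinner]
        simp)
      (fun x => P.rinner_lsmul_self_le c x) u
    have hgT : ∀ v w : E ⊗[ℂ] K, tensorForm π g v w =
        ((‖c‖ : ℂ) ^ 2) * tensorForm π P.rinner v w - tensorForm π P.rinner (T v) (T w) := by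
      intro v w
      induction v with
      | zero => simp
      | add v v' h h' => simp only [map_add, LinearMap.add_apply, h, h']; ring
      | tmul x ξ =>
        induction w with
        | zero => simp
        | add w w' h h' => simp only [map_add, h, h']; ring
        | tmul y η =>
          simp [T, hg]
    rw [hgT, Complex.sub_re] at hpos
    have n1 : ‖t‖ ^ 2 = (tensorForm π P.rinner u u).re := by
      rw [← inner_self_eq_norm_sq (𝕜 := ℂ)]; rfl
    have n2 : ‖P.toPre π (T u)‖ ^ 2 = (tensorForm π P.rinner (T u) (T u)).re := by
      rw [← inner_self_eq_norm_sq (𝕜 := ℂ)]; rfl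
    change ‖P.toPre π (T u)‖ ≤ ‖c‖ * ‖t‖
    refine le_of_sq_le_sq ?_ (by positivity)
    rw [n2, mul_pow, n1]
    have : (((‖c‖ : ℂ) ^ 2) * tensorForm π P.rinner u u).re
        = ‖c‖ ^ 2 * (tensorForm π P.rinner u u).re := by
      rw [← Complex.ofReal_pow, Complex.re_ofReal_mul]
    linarith)

theorem preLeft_tmul (c : C) (x : E) (ξ : K) :
    P.preLeft π c (P.toPre π (x ⊗ₜ ξ)) = P.toPre π (P.lsmul c x ⊗ₜ ξ) := by
  simp [preLeft]

theorem pre_induction {p : P.PreTensor π → Prop} (h0 : p 0)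
    (ht : ∀ x ξ, p (P.toPre π (x ⊗ₜ ξ))) (ha : ∀ s t, p s → p t → p (s + t)) (t) : p t :=
  TensorProduct.induction_on (motive := fun t => p (P.toPre π t)) ((P.toPre π).symm t)
    h0 ht (fun _ _ => ha _ _)

/-- Two bounded linear maps agreeing on elementary tensors agree. -/
theorem ext_tmul {F : Type*} [NormedAddCommGroup F] [NormedSpace ℂ F]
    {S T : P.Tensor π →L[ℂ] F} (h : ∀ x ξ, S (P.tmul π x ξ) = T (P.tmul π x ξ)) : S = T := by
  ext z
  induction z using UniformSpace.Completion.induction_on with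
  | hp => exact isClosed_eq S.continuous T.continuous
  | ih t =>
    induction t using P.pre_induction π with
    | h0 => rw [UniformSpace.Completion.coe_zero, map_zero, map_zero]
    | ht x ξ => exact h x ξ
    | ha s t hs ht => rw [UniformSpace.Completion.coe_add, map_add, map_add, hs, ht]

/-- The operator `x ⊗ ξ ↦ (c · x) ⊗ ξ`. -/
noncomputable def left (c : C) : P.Tensor π →L[ℂ] P.Tensor π := (P.preLeft π c).completion

theorem left_tmul (c : C) (x : E) (ξ : K) :
    P.left π c (P.tmul π x ξ) = P.tmul π (P.lsmul c x) ξ := by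
  simp [left, tmul, preLeft_tmul]

theorem tmul_add_left (x y : E) (ξ : K) :
    P.tmul π (x + y) ξ = P.tmul π x ξ + P.tmul π y ξ := by
  simp [tmul, TensorProduct.add_tmul, UniformSpace.Completion.coe_add]

theorem tmul_smul_left (a : ℂ) (x : E) (ξ : K) :
    P.tmul π (a • x) ξ = a • P.tmul π x ξ := by
  rw [tmul, tmul, ← TensorProduct.smul_tmul', map_smul, UniformSpace.Completion.coe_smul]

/-- The representation of `C` on `E ⊗_B K` induced by `E` and `π`: `c (x ⊗ ξ) = (c · x) ⊗ ξ`. -/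
noncomputable def rep : C →⋆ₙₐ[ℂ] (P.Tensor π →L[ℂ] P.Tensor π) where
  toFun c := P.left π c
  map_smul' a c := P.ext_tmul π fun x ξ => by simp [left_tmul, tmul_smul_left]
  map_zero' := P.ext_tmul π fun x ξ => by
    have := P.tmul_smul_left π 0 0 ξ
    simp only [zero_smul] at this
    simp [left_tmul, this]
  map_add' c c' := P.ext_tmul π fun x ξ => by simp [left_tmul, tmul_add_left]
  map_mul' c c' := P.ext_tmul π fun x ξ => by simp [left_tmul, P.mul_lsmul]
  map_star' c := by
    rw [ContinuousLinearMap.star_eq_adjoint, ContinuousLinearMap.eq_adjoint_iff]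
    intro z w
    have h : ∀ x ξ w, ⟪P.left π (star c) (P.tmul π x ξ), w⟫_ℂ =
        ⟪P.tmul π x ξ, P.left π c w⟫_ℂ := by
      intro x ξ w
      have : (innerSL ℂ (P.left π (star c) (P.tmul π x ξ))) =
          (innerSL ℂ (P.tmul π x ξ)).comp (P.left π c) := P.ext_tmul π fun y η => by
        simp [left_tmul, inner_tmul, P.rinner_lsmul]
      exact congrArg (fun T => T w) this
    have : (innerSL ℂ w).comp (P.left π (star c)) = innerSL ℂ (P.left π c w) :=
      P.ext_tmul π fun x ξ => by
        have := congrArg (starRingEnd ℂ) (h x ξ w)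
        rw [inner_conj_symm, inner_conj_symm] at this
        exact this
    have := congrArg (fun T => (starRingEnd ℂ) (T z)) this
    simpa only [ContinuousLinearMap.comp_apply, innerSL_apply_apply, inner_conj_symm] using this

@[simp]
theorem rep_tmul (c : C) (x : E) (ξ : K) :
    P.rep π c (P.tmul π x ξ) = P.tmul π (P.lsmul c x) ξ := P.left_tmul π c x ξ

end Correspondence

/-! ### Equivalence bimodules, inclusions and conditional expectations -/

/-- A `C`-`D`-equivalence bimodule `Y`: a Banach space that is a full left Hilbert `C`-module and a
full right Hilbert `D`-module (with the same norm), with commuting actions, each of them by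
operators adjointable for the other inner product, and `_C⟨x, y⟩ · z = x · ⟨y, z⟩_D`.
`linner x y` is `_C⟨x, y⟩` (linear in the first variable), `rinner x y` is `⟨x, y⟩_D`. -/
structure EquivalenceBimodule (C D Y : Type*) [NonUnitalCStarAlgebra C] [NonUnitalCStarAlgebra D]
    [PartialOrder C] [PartialOrder D] [NormedAddCommGroup Y] [NormedSpace ℂ Y]
    [CompleteSpace Y] extends Correspondence C D Y where
  linner : Y →ₗ[ℂ] Y →ₗ⋆[ℂ] C
  linner_lsmul : ∀ c x y, linner (lsmul c x) y = c * linner x y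
  star_linner : ∀ x y, star (linner x y) = linner y x
  linner_rsmul : ∀ x d y, linner (rsmul x d) y = linner x (rsmul y (star d))
  linner_self_nonneg : ∀ x, 0 ≤ linner x x
  norm_linner_self : ∀ x, ‖linner x x‖ = ‖x‖ ^ 2
  norm_rinner_self : ∀ x, ‖rinner x x‖ = ‖x‖ ^ 2
  linner_lsmul_eq_rsmul_rinner : ∀ x y z, lsmul (linner x y) z = rsmul x (rinner y z)
  left_full : Dense (Submodule.span ℂ {c | ∃ x y, linner x y = c} : Set C)
  right_full : Dense (Submodule.span ℂ {d | ∃ x y, rinner x y = d} : Set D)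

namespace EquivalenceBimodule

variable {C D Y : Type*} [NonUnitalCStarAlgebra C] [NonUnitalCStarAlgebra D]
    [PartialOrder C] [PartialOrder D] [NormedAddCommGroup Y] [NormedSpace ℂ Y] [CompleteSpace Y]

/-- The inclusions `A ⊆ C` and `B ⊆ D` are strongly Morita equivalent with respect to `Y` (with its
bimodule structure `M`) and its closed subspace `X`. -/
structure InclusionsStronglyMoritaEquivalent (M : EquivalenceBimodule C D Y) (A : NonUnitalStarSubalgebra ℂ C)
    (B : NonUnitalStarSubalgebra ℂ D) (X : Submodule ℂ Y) : Prop where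
  isClosed : IsClosed (X : Set Y)
  lsmul_mem : ∀ a ∈ A, ∀ x ∈ X, M.lsmul a x ∈ X
  rsmul_mem : ∀ x ∈ X, ∀ b ∈ B, M.rsmul x b ∈ X
  linner_mem : ∀ x ∈ X, ∀ y ∈ X, M.linner x y ∈ A
  rinner_mem : ∀ x ∈ X, ∀ y ∈ X, M.rinner x y ∈ B
  linner_dense : closure (Submodule.span ℂ {c | ∃ x ∈ X, ∃ y ∈ X, M.linner x y = c} : Set C) = A
  rinner_dense : closure (Submodule.span ℂ {d | ∃ x ∈ X, ∃ y ∈ X, M.rinner x y = d} : Set D) = B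
  linner_full : Dense (Submodule.span ℂ {c | ∃ y, ∃ x ∈ X, M.linner y x = c} : Set C)
  rinner_full : Dense (Submodule.span ℂ {d | ∃ y, ∃ x ∈ X, M.rinner y x = d} : Set D)

variable {M : EquivalenceBimodule C D Y} {A : NonUnitalStarSubalgebra ℂ C}
    {B : NonUnitalStarSubalgebra ℂ D} {X : Submodule ℂ Y}

/-- `X` as a right Hilbert `A`-`B`-bimodule, with the operations of `Y`. -/
noncomputable def InclusionsStronglyMoritaEquivalent.correspondence [IsClosed (A : Set C)]
    [IsClosed (B : Set D)] (h : M.InclusionsStronglyMoritaEquivalent A B X) : Correspondence A B X where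
  lsmul := LinearMap.mk₂ ℂ (fun a x => ⟨M.lsmul a x, h.lsmul_mem a a.2 x x.2⟩)
    (by intros; ext; simp) (by intros; ext; simp) (by intros; ext; simp) (by intros; ext; simp)
  rsmul := LinearMap.mk₂ ℂ (fun x b => ⟨M.rsmul x b, h.rsmul_mem x x.2 b b.2⟩)
    (by intros; ext; simp) (by intros; ext; simp) (by intros; ext; simp) (by intros; ext; simp)
  rinner := LinearMap.mk₂'ₛₗ (starRingEnd ℂ) (RingHom.id ℂ)
    (fun x y => ⟨M.rinner x y, h.rinner_mem x x.2 y y.2⟩)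
    (by intros; ext; simp) (by intros; ext; simp) (by intros; ext; simp) (by intros; ext; simp)
  mul_lsmul a a' x := Subtype.ext (M.mul_lsmul a a' x)
  rsmul_mul x b b' := Subtype.ext (M.rsmul_mul x b b')
  lsmul_rsmul a x b := Subtype.ext (M.lsmul_rsmul a x b)
  rinner_rsmul x y b := Subtype.ext (M.rinner_rsmul x y b)
  star_rinner x y := Subtype.ext (M.star_rinner x y)
  rinner_lsmul a x y := Subtype.ext (M.rinner_lsmul a x y)
  rinner_self_nonneg x := M.rinner_self_nonneg x

end EquivalenceBimodule

/-- A conditional expectation of `D` onto the C*-subalgebra `B`: a positive contractive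
`B`-bimodule linear map that is the identity on `B`. -/
structure ConditionalExpectation {D : Type*} [NonUnitalCStarAlgebra D] [PartialOrder D]
    (B : NonUnitalStarSubalgebra ℂ D) extends D →L[ℂ] B where
  map_coe : ∀ b : B, toFun b = b
  coe_mul : ∀ (b : B) (d : D), toFun (b * d) = b * toFun d
  mul_coe : ∀ (d : D) (b : B), toFun (d * b) = toFun d * b
  map_nonneg : ∀ d, 0 ≤ d → 0 ≤ toFun d
  norm_le : ∀ d, ‖toFun d‖ ≤ ‖d‖

namespace ConditionalExpectation

variable {D : Type*} [NonUnitalCStarAlgebra D] [PartialOrder D] [StarOrderedRing D]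
    {B : NonUnitalStarSubalgebra ℂ D}

theorem map_star [IsClosed (B : Set D)] (E : ConditionalExpectation B) (d : D) :
    E.toContinuousLinearMap (star d) = star (E.toContinuousLinearMap d) := by
  let f : D →ₚ[ℂ] B := PositiveLinearMap.mk₀ E.toContinuousLinearMap.toLinearMap E.map_nonneg
  exact StarHomClass.map_star f d

/-- `D` as a `D`-`B`-bimodule with the semi-inner product `⟨d, d'⟩ = E (d* d')`. For a
representation `π` of `B` on `K`, the Hilbert space `D ⊗_B K` built from it is the completion of
the algebraic tensor product with respect to `⟨d ⊗ ξ, d' ⊗ η⟩ = ⟨ξ, (π ∘ E)(d* d') η⟩`, and the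
induced representation of `D` is `d (d' ⊗ ξ) = d d' ⊗ ξ`: the Stinespring space and representation
of the completely positive map `π ∘ E`. -/
noncomputable def correspondence [IsClosed (B : Set D)] (E : ConditionalExpectation B) :
    Correspondence D B D where
  lsmul := LinearMap.mul ℂ D
  rsmul := (LinearMap.mul ℂ D).compl₂ (B.toNonUnitalSubalgebra.toSubmodule.subtype)
  rinner := LinearMap.mk₂'ₛₗ (starRingEnd ℂ) (RingHom.id ℂ)
    (fun d d' => E.toContinuousLinearMap (star d * d'))
    (by intros; simp [add_mul]) (by intros; simp [smul_mul_assoc])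
    (by intros; simp [mul_add]) (by intros; simp [mul_smul_comm])
  mul_lsmul c c' x := mul_assoc c c' x
  rsmul_mul x b b' := (mul_assoc x (b : D) b').symm
  lsmul_rsmul c x b := (mul_assoc c x (b : D)).symm
  rinner_rsmul x y b := by
    change E.toContinuousLinearMap (star x * (y * b)) = E.toContinuousLinearMap (star x * y) * b
    rw [← mul_assoc]
    exact E.mul_coe _ _
  star_rinner x y := by simp [← E.map_star]
  rinner_lsmul c x y := by simp [mul_assoc]
  rinner_self_nonneg x := E.map_nonneg _ (star_mul_self_nonneg x)

end ConditionalExpectation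

/-- The net `d` is an approximate unit of `D` consisting of positive elements of norm at most 1. -/
structure IsApproximateUnitNet {D Λ : Type*} [NonUnitalCStarAlgebra D] [PartialOrder D]
    [Preorder Λ] (d : Λ → D) : Prop where
  nonneg : ∀ i, 0 ≤ d i
  norm_le_one : ∀ i, ‖d i‖ ≤ 1
  tendsto_mul_left : ∀ x, Tendsto (fun i => d i * x) atTop (𝓝 x)
  tendsto_mul_right : ∀ x, Tendsto (fun i => x * d i) atTop (𝓝 x)

/-- A representation of a C*-algebra `B` on `K` is non-degenerate if `π(B)K` spans a dense
subspace. -/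
def IsNondegenerate {B K : Type*} [NonUnitalCStarAlgebra B] [NormedAddCommGroup K]
    [InnerProductSpace ℂ K] [CompleteSpace K] (π : B →⋆ₙₐ[ℂ] (K →L[ℂ] K)) : Prop :=
  Dense (Submodule.span ℂ {η : K | ∃ b ξ, π b ξ = η} : Set K)

/-- The condition that the closed linear span of `AC` is `C`. -/
def IsNondegenerateInclusion {C : Type*} [NonUnitalCStarAlgebra C]
    (A : NonUnitalStarSubalgebra ℂ C) : Prop :=
  Dense (Submodule.span ℂ {z : C | ∃ a ∈ A, ∃ c, a * c = z} : Set C)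

/-- The bounded bimodule linear maps `φ : C → A` and `ψ : D → B` are strongly Morita equivalent
with respect to `Y` (with its bimodule structure `M`) and its closed subspace `X`: the inclusions
are, and there is a bounded linear map `Φ : Y → X` compatible with `φ`, `ψ`, the actions and the
inner products. -/
structure EquivalenceBimodule.MapsStronglyMoritaEquivalent {C D Y : Type*} [NonUnitalCStarAlgebra C]
    [NonUnitalCStarAlgebra D] [PartialOrder C] [PartialOrder D] [NormedAddCommGroup Y]
    [NormedSpace ℂ Y] [CompleteSpace Y] (M : EquivalenceBimodule C D Y)
    {A : NonUnitalStarSubalgebra ℂ C} {B : NonUnitalStarSubalgebra ℂ D} (X : Submodule ℂ Y)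
    (φ : C →L[ℂ] A) (ψ : D →L[ℂ] B) : Prop where
  inclusion : M.InclusionsStronglyMoritaEquivalent A B X
  exists_map : ∃ Φ : Y →L[ℂ] X,
    (∀ c, ∀ x : X, (Φ (M.lsmul c x) : Y) = M.lsmul (φ c) x) ∧
    (∀ a : A, ∀ y, (Φ (M.lsmul a y) : Y) = M.lsmul a (Φ y)) ∧
    (∀ y, ∀ x : X, (φ (M.linner y x) : C) = M.linner (Φ y) x) ∧
    (∀ d, ∀ x : X, (Φ (M.rsmul x d) : Y) = M.rsmul x (ψ d)) ∧
    (∀ b : B, ∀ y, (Φ (M.rsmul y b) : Y) = M.rsmul (Φ y) b) ∧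
    (∀ y, ∀ x : X, (ψ (M.rinner y x) : D) = M.rinner (Φ y) x)

end MoritaMaps

open MoritaMaps

namespace MoritaMaps

theorem norm_le_of_le_mul_mul {x y : ℝ} (hx : 0 ≤ x) (hy : 0 ≤ y) {k : ℝ}
    (h : x ^ 2 ≤ k * x * y) (hk : 0 ≤ k) : x ≤ k * y := by
  rcases hx.eq_or_lt with h0 | h0
  · rw [← h0]; positivity
  · refine le_of_mul_le_mul_left ?_ h0
    nlinarith

/-! ### Norm estimates and approximate units in an equivalence bimodule -/

namespace EquivalenceBimodule

variable {C D Y : Type*} [NonUnitalCStarAlgebra C] [NonUnitalCStarAlgebra D]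
    [PartialOrder C] [PartialOrder D] [NormedAddCommGroup Y] [NormedSpace ℂ Y] [CompleteSpace Y]
    (M : EquivalenceBimodule C D Y)

theorem rinner_rsmul_left (x y : Y) (d : D) :
    M.rinner (M.rsmul x d) y = star d * M.rinner x y := by
  rw [← M.star_rinner, M.rinner_rsmul, star_mul, M.star_rinner]

theorem rinner_smul_left (a : ℂ) (x y : Y) :
    M.rinner (a • x) y = starRingEnd ℂ a • M.rinner x y := by
  rw [LinearMap.map_smulₛₗ, LinearMap.smul_apply]

/-- Polarization expresses a general inner product through diagonal ones, whose norms are known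
exactly. The signs of the `Complex.I` terms reflect conjugate linearity in the first variable. -/
theorem four_smul_rinner (x y : Y) : (4 : ℂ) • M.rinner x y =
    M.rinner (x + y) (x + y) - M.rinner (x - y) (x - y)
      - Complex.I • M.rinner (x + Complex.I • y) (x + Complex.I • y)
      + Complex.I • M.rinner (x - Complex.I • y) (x - Complex.I • y) := by
  simp only [map_add, map_sub, LinearMap.add_apply, LinearMap.sub_apply, M.rinner_smul_left,
    map_smul, Complex.conj_I, smul_add, smul_sub, smul_smul, neg_smul, Complex.I_mul_I]
  match_scalars <;> ring_nf <;> norm_num [Complex.I_sq]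

/-- A non-sharp Cauchy-Schwarz inequality, from polarization. -/
theorem norm_rinner_le (x y : Y) : ‖M.rinner x y‖ ≤ 4 * ‖x‖ * ‖y‖ := by
  -- On the unit ball each of the four diagonal terms has norm at most `2 ^ 2`, so four times the
  -- inner product has norm at most 16.
  have unit : ∀ x y : Y, ‖x‖ ≤ 1 → ‖y‖ ≤ 1 → ‖M.rinner x y‖ ≤ 4 := by
    intro x y hx hy
    have key : ∀ z w : Y, ‖z‖ ≤ 1 → ‖w‖ ≤ 1 → ‖z + w‖ ^ 2 ≤ 4 := fun z w hz hw => by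
      have := norm_add_le z w
      nlinarith [norm_nonneg (z + w)]
    have hI : ‖Complex.I • y‖ ≤ 1 := by simpa [norm_smul] using hy
    have h1 := key x y hx hy
    have h2 := key x (-y) hx (by simpa using hy)
    have h3 := key x (Complex.I • y) hx hI
    have h4 := key x (-(Complex.I • y)) hx (by simpa using hI)
    rw [← sub_eq_add_neg] at h2 h4
    rw [← M.norm_rinner_self] at h1 h2 h3 h4
    have h := congrArg norm (M.four_smul_rinner x y)
    rw [norm_smul, Complex.norm_ofNat] at h
    have ht := norm_add_le
      (M.rinner (x + y) (x + y) - M.rinner (x - y) (x - y)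
        - Complex.I • M.rinner (x + Complex.I • y) (x + Complex.I • y))
      (Complex.I • M.rinner (x - Complex.I • y) (x - Complex.I • y))
    have ht2 := norm_sub_le (M.rinner (x + y) (x + y) - M.rinner (x - y) (x - y))
      (Complex.I • M.rinner (x + Complex.I • y) (x + Complex.I • y))
    have ht3 := norm_sub_le (M.rinner (x + y) (x + y)) (M.rinner (x - y) (x - y))
    rw [norm_smul, Complex.norm_I, one_mul] at ht ht2
    linarith
  rcases eq_or_ne x 0 with rfl | hx
  · simp
  rcases eq_or_ne y 0 with rfl | hy
  · simp
  have hx' := norm_pos_iff.mpr hx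
  have hy' := norm_pos_iff.mpr hy
  have h := unit (((‖x‖⁻¹ : ℝ) : ℂ) • x) (((‖y‖⁻¹ : ℝ) : ℂ) • y)
    (by simp [norm_smul, hx]) (by simp [norm_smul, hy])
  rw [M.rinner_smul_left, map_smul, norm_smul, norm_smul] at h
  simp only [Complex.conj_ofReal, Complex.norm_real, norm_inv, norm_norm] at h
  rw [← mul_assoc, ← mul_inv, inv_mul_le_iff₀ (by positivity)] at h
  linarith

theorem norm_rsmul_le (y : Y) (d : D) : ‖M.rsmul y d‖ ≤ ‖y‖ * ‖d‖ := by
  refine le_of_sq_le_sq ?_ (by positivity)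
  rw [← M.norm_rinner_self, M.rinner_rsmul, M.rinner_rsmul_left]
  calc ‖star d * M.rinner y y * d‖ ≤ ‖star d‖ * ‖M.rinner y y‖ * ‖d‖ :=
        (norm_mul_le _ _).trans (by gcongr; exact norm_mul_le _ _)
    _ = (‖y‖ * ‖d‖) ^ 2 := by rw [norm_star, M.norm_rinner_self]; ring

theorem continuous_rinner_right (x : Y) : Continuous (M.rinner x) :=
  AddMonoidHomClass.continuous_of_bound (M.rinner x) (4 * ‖x‖) fun y => M.norm_rinner_le x y

theorem continuous_rsmul_right (y : Y) : Continuous (M.rsmul y) :=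
  AddMonoidHomClass.continuous_of_bound (M.rsmul y) ‖y‖ fun d => M.norm_rsmul_le y d

/-- An approximate unit of `D` acts on the right of `Y` as an approximate unit. -/
theorem tendsto_rsmul {Λ : Type*} [Preorder Λ] {d : Λ → D} (hd : IsApproximateUnitNet d) (y : Y) :
    Tendsto (fun i => M.rsmul y (d i)) atTop (𝓝 y) := by
  rw [tendsto_iff_norm_sub_tendsto_zero]
  have hsq : Tendsto (fun i => ‖M.rsmul y (d i) - y‖ ^ 2) atTop (𝓝 0) := by
    -- Formally `⟨yd - y, yd - y⟩ = (d* - 1)(⟨y, y⟩d - ⟨y, y⟩)`; the factor 2 bounds `d* - 1`, as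
    -- `‖d‖ ≤ 1`.
    have hb : ∀ i, ‖M.rsmul y (d i) - y‖ ^ 2 ≤ 2 * ‖M.rinner y y * d i - M.rinner y y‖ := by
      intro i
      have e : M.rinner (M.rsmul y (d i) - y) (M.rsmul y (d i) - y) =
          star (d i) * (M.rinner y y * d i - M.rinner y y)
            - (M.rinner y y * d i - M.rinner y y) := by
        simp only [map_sub, LinearMap.sub_apply, M.rinner_rsmul, M.rinner_rsmul_left, mul_sub,
          mul_assoc]
        abel
      rw [← M.norm_rinner_self, e]
      refine (norm_sub_le _ _).trans ?_
      have h1 := norm_mul_le (star (d i)) (M.rinner y y * d i - M.rinner y y)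
      rw [norm_star] at h1
      nlinarith [hd.norm_le_one i, norm_nonneg (M.rinner y y * d i - M.rinner y y)]
    have hl := (tendsto_iff_norm_sub_tendsto_zero.mp (hd.tendsto_mul_right (M.rinner y y))).const_mul
      2
    rw [mul_zero] at hl
    exact squeeze_zero (fun i => by positivity) hb hl
  have := hsq.sqrt
  simpa [Real.sqrt_sq] using this

variable {M}

/-! ### Construction of the map from `Y` to `X` -/

namespace InclusionsStronglyMoritaEquivalent

variable {A : NonUnitalStarSubalgebra ℂ C} {B : NonUnitalStarSubalgebra ℂ D} {X : Submodule ℂ Y}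
  (h : M.InclusionsStronglyMoritaEquivalent A B X)
include h

/-- A closed subspace of `Y` containing `C · X` is all of `Y`. -/
theorem eq_top_of_lsmul_mem {Λ : Type*} [Preorder Λ] [IsDirectedOrder Λ] [Nonempty Λ] {d : Λ → D}
    (hd : IsApproximateUnitNet d) (S : Submodule ℂ Y) (hS : IsClosed (S : Set Y))
    (hmem : ∀ c, ∀ x ∈ X, M.lsmul c x ∈ S) : S = ⊤ := by
  have hr : ∀ y e, M.rsmul y e ∈ S := by
    intro y e
    -- Since `y · ⟨y', x⟩_D = _C⟨y, y'⟩ · x` lies in `C · X`, density of the span of `⟨Y, X⟩_D` in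
    -- `D` puts all of `y · D` in `S`; the approximate unit then recovers `y`.
    have hspan : Submodule.span ℂ {d | ∃ y, ∃ x ∈ X, M.rinner y x = d} ≤ S.comap (M.rsmul y) := by
      rw [Submodule.span_le]
      rintro _ ⟨y', x, hx, rfl⟩
      change M.rsmul y (M.rinner y' x) ∈ S
      rw [← M.linner_lsmul_eq_rsmul_rinner]
      exact hmem _ x hx
    have hcl : IsClosed ((S.comap (M.rsmul y) : Submodule ℂ D) : Set D) :=
      hS.preimage (M.continuous_rsmul_right y)
    exact closure_minimal hspan hcl (h.rinner_full e)
  rw [eq_top_iff]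
  intro y _
  exact hS.mem_of_tendsto (M.tendsto_rsmul hd y) (Eventually.of_forall fun i => hr y (d i))

/-- `A` acts faithfully on `X`. -/
theorem eq_zero_of_lsmul_eq_zero {a : C} (ha : a ∈ A) (h0 : ∀ x ∈ X, M.lsmul a x = 0) : a = 0 := by
  have hspan : Submodule.span ℂ {c | ∃ x ∈ X, ∃ y ∈ X, M.linner x y = c} ≤
      LinearMap.ker (LinearMap.mul ℂ C a) := by
    rw [Submodule.span_le]
    rintro _ ⟨x, hx, y, -, rfl⟩
    change a * M.linner x y = 0
    rw [← M.linner_lsmul, h0 x hx, map_zero, LinearMap.zero_apply]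
  have hcl : IsClosed ((LinearMap.ker (LinearMap.mul ℂ C a) : Submodule ℂ C) : Set C) :=
    isClosed_eq (continuous_const.mul continuous_id) continuous_const
  -- Left multiplication by `a` kills `_C⟨X, X⟩`, hence its closed span `A`, hence `a*`; so `a a* =
  -- 0`.
  have hmem : star a ∈ closure
      (Submodule.span ℂ {c | ∃ x ∈ X, ∃ y ∈ X, M.linner x y = c} : Set C) := by
    rw [h.linner_dense]
    exact star_mem ha
  exact CStarRing.mul_star_self_eq_zero_iff a |>.mp (closure_minimal hspan hcl hmem)

/-- The difference `w - w'` is itself an admissible test vector because it lies in `X`. -/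
theorem ext_rinner {w w' : Y} (hw : w ∈ X) (hw' : w' ∈ X)
    (he : ∀ z ∈ X, M.rinner z w = M.rinner z w') : w = w' := by
  rw [← sub_eq_zero, ← norm_eq_zero, ← sq_eq_zero_iff, ← M.norm_rinner_self, map_sub _ w w',
    he _ (X.sub_mem hw hw'), sub_self, norm_zero]

variable (M X) in
omit h in
/-- The vectors `y` for which the functional `z ↦ E ⟨z, y⟩_D` on `X` is represented by a vector
of `X`. -/
def representable (E : ConditionalExpectation B) : Submodule ℂ Y where
  carrier := {y | ∃ w ∈ X, ∀ z ∈ X, M.rinner z w = E.toContinuousLinearMap (M.rinner z y)}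
  zero_mem' := ⟨0, X.zero_mem, by simp⟩
  add_mem' := by
    rintro y y' ⟨w, hw, e⟩ ⟨w', hw', e'⟩
    exact ⟨w + w', X.add_mem hw hw', fun z hz => by simp [e z hz, e' z hz]⟩
  smul_mem' := by
    rintro a y ⟨w, hw, e⟩
    exact ⟨a • w, X.smul_mem a hw, fun z hz => by simp [e z hz]⟩

omit h in
-- Testing with `z = w` gives `‖w‖² = ‖E ⟨w, y⟩‖ ≤ 4 ‖w‖ ‖y‖`, as `E` is contractive. This bound
-- serves both to make representatives of a convergent sequence Cauchy and to make `Φ` bounded.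
theorem norm_le_of_represents {E : ConditionalExpectation B} {y w : Y} (hw : w ∈ X)
    (e : ∀ z ∈ X, M.rinner z w = E.toContinuousLinearMap (M.rinner z y)) : ‖w‖ ≤ 4 * ‖y‖ := by
  refine norm_le_of_le_mul_mul (norm_nonneg _) (norm_nonneg _) ?_ (by norm_num)
  rw [← M.norm_rinner_self, e w hw]
  exact (E.norm_le _).trans (M.norm_rinner_le w y)

/-- Differences of representatives represent differences, so the norm bound carries Cauchy sequences
in `Y` to Cauchy sequences in `X`. The limit stays in the closed subspace `X`, and the defining
relation passes to the limit by continuity. -/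
theorem isClosed_representable (E : ConditionalExpectation B) :
    IsClosed (representable M X E : Set Y) := by
  refine isClosed_of_closure_subset fun y hy => ?_
  obtain ⟨u, hu, hlim⟩ := mem_closure_iff_seq_limit.mp hy
  choose w hw e using hu
  have hcau : CauchySeq w := by
    refine cauchySeq_iff_tendsto_dist_atTop_0.mpr ?_
    have hc := (cauchySeq_iff_tendsto_dist_atTop_0.mp hlim.cauchySeq).const_mul 4
    rw [mul_zero] at hc
    refine squeeze_zero (fun _ => dist_nonneg) (fun n => ?_) hc
    rw [dist_eq_norm, dist_eq_norm]
    refine norm_le_of_represents (M := M) (E := E) (X.sub_mem (hw _) (hw _)) fun z hz => ?_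
    simp [e _ z hz]
  obtain ⟨w₀, hw₀⟩ := cauchySeq_tendsto_of_complete hcau
  refine ⟨w₀, h.isClosed.mem_of_tendsto hw₀ (Eventually.of_forall hw), fun z hz => ?_⟩
  have h1 := ((M.continuous_rinner_right z).tendsto w₀).comp hw₀
  have h2 := ((continuous_subtype_val.comp (E.toContinuousLinearMap.continuous.comp
    (M.continuous_rinner_right z))).tendsto y).comp hlim
  refine tendsto_nhds_unique h1 (h2.congr fun n => ?_)
  exact (e n z hz).symm

/-- If `E_B ⟨x, c · x'⟩ = ⟨x, E_A c · x'⟩` on `X`, then `E_A` and `E_B` are strongly Morita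
equivalent. -/
theorem mapsStronglyMoritaEquivalent [StarOrderedRing D] [IsClosed (B : Set D)]
    {Λ : Type*} [Preorder Λ] [IsDirectedOrder Λ] [Nonempty Λ] {d : Λ → D}
    (hd : IsApproximateUnitNet d) (EA : ConditionalExpectation A) (EB : ConditionalExpectation B)
    (hE : ∀ c, ∀ x ∈ X, ∀ x' ∈ X, (EB.toContinuousLinearMap (M.rinner x (M.lsmul c x')) : D) =
      M.rinner x (M.lsmul (EA.toContinuousLinearMap c) x')) :
    M.MapsStronglyMoritaEquivalent X EA.toContinuousLinearMap EB.toContinuousLinearMap := by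
  have htop := h.eq_top_of_lsmul_mem hd (representable M X EB) (h.isClosed_representable EB)
    fun c x hx => ⟨M.lsmul (EA.toContinuousLinearMap c) x,
      h.lsmul_mem _ (EA.toContinuousLinearMap c).2 x hx, fun z hz => (hE c z hz x hx).symm⟩
  have hex : ∀ y, ∃ w ∈ X, ∀ z ∈ X, M.rinner z w = EB.toContinuousLinearMap (M.rinner z y) :=
    fun y => (htop ▸ Submodule.mem_top : y ∈ representable M X EB)
  choose F hF e using hex
  let Φ : Y →L[ℂ] X := LinearMap.mkContinuous
    { toFun := fun y => ⟨F y, hF y⟩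
      map_add' := fun y y' => Subtype.ext <| h.ext_rinner (hF _) (X.add_mem (hF _) (hF _))
        fun z hz => by simp [e _ z hz]
      map_smul' := fun a y => Subtype.ext <| h.ext_rinner (hF _) (X.smul_mem _ (hF _))
        fun z hz => by simp [e _ z hz] } 4 fun y => norm_le_of_represents (hF y) (e y)
  have hΦ : ∀ y, ∀ z ∈ X, M.rinner z (Φ y) = EB.toContinuousLinearMap (M.rinner z y) :=
    fun y z hz => e y z hz
  have hleft : ∀ c, ∀ x : X, (Φ (M.lsmul c x) : Y) = M.lsmul (EA.toContinuousLinearMap c) x :=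
    fun c x => h.ext_rinner (Φ _).2 (h.lsmul_mem _ (EA.toContinuousLinearMap c).2 x x.2)
      fun z hz => by rw [hΦ _ z hz, hE c z hz x x.2]
  have hright : ∀ b : B, ∀ y, (Φ (M.rsmul y b) : Y) = M.rsmul (Φ y) b :=
    fun b y => h.ext_rinner (Φ _).2 (h.rsmul_mem _ (Φ y).2 b b.2) fun z hz => by
      rw [hΦ _ z hz, M.rinner_rsmul, M.rinner_rsmul, hΦ y z hz]
      exact congrArg Subtype.val (EB.mul_coe (M.rinner z y) b)
  refine ⟨h, Φ, hleft, fun a y => ?_, fun y x => ?_, fun f x => ?_, hright, fun y x => ?_⟩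
  · refine h.ext_rinner (Φ _).2 (h.lsmul_mem _ a.2 _ (Φ y).2) fun z hz => ?_
    have hs : ∀ u, M.rinner z (M.lsmul (a : C) u) = M.rinner (M.lsmul (star (a : C)) z) u :=
      fun u => by rw [M.rinner_lsmul, star_star]
    rw [hΦ _ z hz, hs, hs, hΦ y _ (h.lsmul_mem _ (star_mem a.2) z hz)]
  -- Both sides lie in `A`, so it suffices to compare their actions on `z` in `X`: `E_A(_C⟨y, x⟩) ·
  -- z = Φ(_C⟨y, x⟩ · z) = Φ(y · ⟨x, z⟩) = Φ(y) · ⟨x, z⟩ = _C⟨Φ(y), x⟩ · z`.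
  · rw [← sub_eq_zero]
    refine h.eq_zero_of_lsmul_eq_zero (sub_mem (EA.toContinuousLinearMap _).2
      (h.linner_mem _ (Φ y).2 x x.2)) fun z hz => ?_
    rw [map_sub, LinearMap.sub_apply, ← hleft _ ⟨z, hz⟩, M.linner_lsmul_eq_rsmul_rinner,
      M.linner_lsmul_eq_rsmul_rinner, hright ⟨M.rinner x z, h.rinner_mem x x.2 z hz⟩ y, sub_self]
  -- Here `⟨z, x⟩` already lies in `B`, so it can be pulled out of `E_B` on the left.
  · refine h.ext_rinner (Φ _).2 (h.rsmul_mem _ x.2 _ (EB.toContinuousLinearMap f).2)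
      fun z hz => ?_
    rw [hΦ _ z hz, M.rinner_rsmul, M.rinner_rsmul]
    exact congrArg Subtype.val (EB.coe_mul ⟨M.rinner z x, h.rinner_mem z hz x x.2⟩ f)
  · rw [← M.star_rinner x (Φ y), hΦ y x x.2, ← M.star_rinner x y, EB.map_star]
    rfl

end InclusionsStronglyMoritaEquivalent

end EquivalenceBimodule

/-! ### Matrix coefficients of the compressed representation -/

theorem inner_rep_right {C H : Type*} [NonUnitalCStarAlgebra C] [NormedAddCommGroup H]
    [InnerProductSpace ℂ H] [CompleteSpace H] (ρ : C →⋆ₙₐ[ℂ] (H →L[ℂ] H)) (c : C) (z w : H) :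
    inner ℂ z (ρ c w) = inner ℂ (ρ (star c) z) w := by
  rw [map_star, ContinuousLinearMap.star_eq_adjoint, ContinuousLinearMap.adjoint_inner_left]

theorem inner_compression {H H' : Type*} [NormedAddCommGroup H] [InnerProductSpace ℂ H]
    [CompleteSpace H] [NormedAddCommGroup H'] [InnerProductSpace ℂ H'] [CompleteSpace H']
    (V : H →L[ℂ] H') (T : H' →L[ℂ] H') (z w : H) :
    inner ℂ z ((V.adjoint ∘L T ∘L V) w) = inner ℂ (V z) (T (V w)) :=
  ContinuousLinearMap.adjoint_inner_right V z (T (V w))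

/-- Compressing the representation of `C` on `Y ⊗_D (D ⊗_B K)` along the weak limit `V` of
`x ⊗ ξ ↦ x ⊗ (d i ⊗ ξ)` gives the matrix coefficients of `π ∘ E`. -/
theorem inner_rep_weak_limit {C D Y K Λ : Type*} [NonUnitalCStarAlgebra C]
    [NonUnitalCStarAlgebra D] [PartialOrder D] [StarOrderedRing D]
    {B : NonUnitalStarSubalgebra ℂ D} [IsClosed (B : Set D)] (E : ConditionalExpectation B)
    [AddCommGroup Y] [Module ℂ Y] (P : Correspondence C D Y)
    [NormedAddCommGroup K] [InnerProductSpace ℂ K] [CompleteSpace K]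
    (π : B →⋆ₙₐ[ℂ] (K →L[ℂ] K)) [Preorder Λ] [IsDirectedOrder Λ] [Nonempty Λ] {d : Λ → D}
    (hd : IsApproximateUnitNet d) {x x' : Y} {ξ ξ' : K}
    {v v' : P.Tensor (E.correspondence.rep π)}
    (hv : ∀ z, Tendsto (fun i => inner ℂ z (P.tmul (E.correspondence.rep π) x
      (E.correspondence.tmul π (d i) ξ))) atTop (𝓝 (inner ℂ z v)))
    (hv' : ∀ z, Tendsto (fun i => inner ℂ z (P.tmul (E.correspondence.rep π) x'
      (E.correspondence.tmul π (d i) ξ'))) atTop (𝓝 (inner ℂ z v'))) (c : C) :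
    inner ℂ v (P.rep (E.correspondence.rep π) c v') =
      inner ℂ ξ (π (E.toContinuousLinearMap (P.rinner x (P.lsmul c x'))) ξ') := by
  have hcont : Continuous fun a : D => inner ℂ ξ (π (E.toContinuousLinearMap a) ξ') := by
    have h1 : Continuous π := map_continuous π
    have h2 : Continuous fun a : D => π (E.toContinuousLinearMap a) :=
      h1.comp E.toContinuousLinearMap.continuous
    fun_prop
  have hpair : ∀ i j, inner ℂ (P.tmul (E.correspondence.rep π) x (E.correspondence.tmul π (d i) ξ))
      (P.rep (E.correspondence.rep π) c
        (P.tmul (E.correspondence.rep π) x' (E.correspondence.tmul π (d j) ξ'))) =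
      inner ℂ ξ (π (E.toContinuousLinearMap
        (d i * (P.rinner x (P.lsmul c x') * d j))) ξ') := by
    intro i j
    rw [P.rep_tmul, P.inner_tmul, Correspondence.rep_tmul, Correspondence.inner_tmul]
    conv_rhs => rw [← (hd.nonneg i).isSelfAdjoint.star_eq]
    rfl
  have hmove : ∀ z w, inner ℂ z (P.rep (E.correspondence.rep π) c w) =
      inner ℂ (P.rep (E.correspondence.rep π) (star c) z) w :=
    inner_rep_right (P.rep (E.correspondence.rep π)) c
  -- The vectors converge only weakly, so the two limits cannot be taken simultaneously. The limit
  -- in `j` is taken first with `i` fixed, after moving `c` to the other side; the limit in `i`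
  -- follows, conjugated because the varying vector sits in the first slot.
  have hone : ∀ i, inner ℂ (P.tmul (E.correspondence.rep π) x (E.correspondence.tmul π (d i) ξ))
      (P.rep (E.correspondence.rep π) c v') =
      inner ℂ ξ (π (E.toContinuousLinearMap (d i * P.rinner x (P.lsmul c x'))) ξ') := by
    intro i
    have h1 := hv' (P.rep (E.correspondence.rep π) (star c)
      (P.tmul (E.correspondence.rep π) x (E.correspondence.tmul π (d i) ξ)))
    simp only [← hmove, hpair] at h1
    exact tendsto_nhds_unique h1 ((hcont.tendsto _).comp
      ((hd.tendsto_mul_right (P.rinner x (P.lsmul c x'))).const_mul (d i)))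
  have h1 := (Complex.continuous_conj.tendsto _).comp (hv (P.rep (E.correspondence.rep π) c v'))
  simp only [Function.comp_def, inner_conj_symm, hone] at h1
  exact tendsto_nhds_unique h1 ((hcont.tendsto _).comp
    (hd.tendsto_mul_left (P.rinner x (P.lsmul c x'))))

end MoritaMaps

theorem proposition5p10
    {C D Y K Λ : Type*}
    [NonUnitalCStarAlgebra C] [PartialOrder C] [StarOrderedRing C]
    [NonUnitalCStarAlgebra D] [PartialOrder D] [StarOrderedRing D]
    (A : NonUnitalStarSubalgebra ℂ C) (B : NonUnitalStarSubalgebra ℂ D)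
    [IsClosed (A : Set C)] [IsClosed (B : Set D)]
    (hAC : IsNondegenerateInclusion A) (hBD : IsNondegenerateInclusion B)
    (EA : ConditionalExpectation A) (EB : ConditionalExpectation B)
    [NormedAddCommGroup Y] [NormedSpace ℂ Y] [CompleteSpace Y]
    (M : EquivalenceBimodule C D Y) (X : Submodule ℂ Y)
    (hX : M.InclusionsStronglyMoritaEquivalent A B X)
    [NormedAddCommGroup K] [InnerProductSpace ℂ K] [CompleteSpace K]
    (πB : B →⋆ₙₐ[ℂ] (K →L[ℂ] K))
    (hπB : IsNondegenerate πB)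
    (hfaithful : Function.Injective πB)
    [Preorder Λ] [IsDirectedOrder Λ] [Nonempty Λ] (d : Λ → D) (hd : IsApproximateUnitNet d)
    (V : hX.correspondence.Tensor πB →L[ℂ]
      M.toCorrespondence.Tensor (EB.correspondence.rep πB))
    (hV : ∀ (x : X) (ξ : K) (z : M.toCorrespondence.Tensor (EB.correspondence.rep πB)),
      Tendsto (fun i => inner ℂ z (M.toCorrespondence.tmul (EB.correspondence.rep πB) (x : Y)
          (EB.correspondence.tmul πB (d i) ξ))) atTop
        (𝓝 (inner ℂ z (V (hX.correspondence.tmul πB x ξ)))))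
    (hdil : ∀ c : C, hX.correspondence.rep πB (EA.toContinuousLinearMap c) =
      V.adjoint ∘L M.toCorrespondence.rep (EB.correspondence.rep πB) c ∘L V) :
    M.MapsStronglyMoritaEquivalent X EA.toContinuousLinearMap EB.toContinuousLinearMap := by
  refine hX.mapsStronglyMoritaEquivalent hd EA EB fun c x hx x' hx' => ?_
  -- The identity is stated in `B` rather than in `D`, so that injectivity of `πB` applies to it.
  have key : EB.toContinuousLinearMap (M.rinner x (M.lsmul c x')) =
      hX.correspondence.rinner ⟨x, hx⟩
        (hX.correspondence.lsmul (EA.toContinuousLinearMap c) ⟨x', hx'⟩) := by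
    refine hfaithful (ContinuousLinearMap.ext fun ξ' => ext_inner_left ℂ fun ξ => ?_)
    have h1 := inner_rep_weak_limit EB M.toCorrespondence πB hd (hV ⟨x, hx⟩ ξ) (hV ⟨x', hx'⟩ ξ') c
    rw [← inner_compression V, ← hdil, Correspondence.rep_tmul, Correspondence.inner_tmul] at h1
    exact h1.symm
  exact congrArg Subtype.val key
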